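/- Let $\beta_k,\alpha_k^L,\alpha_k^R$ ($k\ge 0$) be polynomials with complex coefficients, not identically zero, of degree at most $1$, with uniformly bounded coefficients. Define $p_n,q_n$ by $$q_0=1,\quad q_1=\beta_0,\quad p_0=0,\quad p_1=1,\qquad y_{n+1}=\beta_n\,y_n-\alpha^L_{n-1}\alpha^R_{n-1}\,y_{n-1}\quad(n\ge 1,\ y=p,q),$$ so that $p_n/q_n$ is the $n$th convergent of the continued fraction $$\cfrac{1}{\beta_0-\cfrac{\alpha_0^L\alpha_0^R}{\beta_1-\cfrac{\alpha_1^L\alpha_1^R}{\beta_2-\cdots}}}.$$ Let $zB-A$ be the infinite tridiagonal pencil with diagonal entries $\beta_k(z)$, entries $-\alpha_k^R(z)$ at positions $(k,k+1)$ and $-\alpha_k^L(z)$ at positions $(k+1,k)$ ($k\ge0$). The matrices $A,B$ have bounded entries and act as bounded operators on $\ell^2$. Let $\rho(A,B)\subset\mathbb C\cup\{\infty\}$ consist of all $z\in\mathbb C$ for which $zB-A$ has a bounded inverse, together with $\infty$ if and only if $B$ has a bounded inverse, and let $m(z)=\langle (zB-A)^{-1}e_0,e_0\rangle$ for $z\in\rho(A,B)\cap\mathbb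 C$. For $k\ge 0$ let $z_{2k+1}$ and $z_{2k+2}$ be the roots of $\alpha_k^L$ and $\alpha_k^R$, respectively, where the root is $\infty$ if the polynomial has degree $0$. Suppose that there is a domain $\Gamma_{ext}\subset\mathbb C\cup\{\infty\}$ whose boundary is a Jordan curve in $\mathbb C$, such that $$z_1,z_2,\ldots\in\Gamma_{ext}\subset\operatorname{Clos}(\Gamma_{ext})\subset\rho(A,B)$$ (closure in $\mathbb C\cup\{\infty\}$), and such that $\infty\in\Gamma_{ext}$ if $\infty\in\rho(A,B)$. Then for every $n\ge 0$ the rational function $p_n/q_n$ is an $[n-1|n]$ multipoint Padé approximant of $m$ at $z_1,\ldots,z_{2n}$, counting multiplicities. That is: $\deg p_n\le n-1$ ($p_0=0$), $\deg q_n\le n$, $q_n\not\equiv 0$; if $w\in\mathbb C$ occurs exactly $\mu\ge 1$ times among $z_1,\ldots,z_{2n}$, then $m q_n-p_n$ is analytic at $w$ and has a zero of order at least $\mu$ there; and if $\infty$ occurs exactly $\mu\ge 1$ times among $z_1,\ldots,z_{2n}$, then in a neighbourhood of $\infty$ one has $m(z)q_n(z)-p_n(z)=z^{\,n-1-\mu}g(1/z)$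 with $g$ analytic at $0$. -/

import Mathlib

open Polynomial Filter Topology OnePoint

noncomputable section

/-- The Hilbert space of square summable complex sequences indexed by `0, 1, 2, …`. -/
abbrev Ell2 : Type := lp (fun _ : ℕ => ℂ) 2

/-- The canonical unit vector `e_k`. -/
def unitVec (k : ℕ) : Ell2 := lp.single 2 k (1 : ℂ)

/-- The infinite matrix `T` is tridiagonal. -/
def IsTridiagonal (T : ℕ → ℕ → ℂ) : Prop :=
  ∀ i j, i + 1 < j ∨ j + 1 < i → T i j = 0

/-- The entries of the infinite matrix `T` are uniformly bounded. -/
def HasBoundedEntries (T : ℕ → ℕ → ℂ) : Prop :=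
  ∃ C : ℝ, ∀ i j, ‖T i j‖ ≤ C

/-- The usual matrix product `T y` for tridiagonal `T`: the `j`-th term of row `i` vanishes
for `j ≥ i + 2`, so that the row sum is finite. -/
def matVec (T : ℕ → ℕ → ℂ) (y : ℕ → ℂ) (i : ℕ) : ℂ :=
  ∑ j ∈ Finset.range (i + 2), T i j * y j

theorem norm_matVec_le {T : ℕ → ℕ → ℂ} (hT : IsTridiagonal T) {C : ℝ}
    (hC : ∀ i j, ‖T i j‖ ≤ C) (y : ℕ → ℂ) (i : ℕ) :
    ‖matVec T y i‖ ≤ C * (‖y (i - 1)‖ + ‖y i‖ + ‖y (i + 1)‖) := by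
  have h : ∀ i j, ‖T i j * y j‖ ≤ C * ‖y j‖ := fun i j => by
    rw [norm_mul]; exact mul_le_mul_of_nonneg_right (hC i j) (norm_nonneg _)
  have hC0 : 0 ≤ C := (norm_nonneg _).trans (hC 0 0)
  cases i with
  | zero =>
    have e : matVec T y 0 = T 0 0 * y 0 + T 0 1 * y 1 := by
      simp [matVec, Finset.sum_range_succ]
    rw [e]
    have := norm_add_le (T 0 0 * y 0) (T 0 1 * y 1)
    have h0 := h 0 0
    have h1 := h 0 1
    have := mul_nonneg hC0 (norm_nonneg (y 0))
    simp only [Nat.zero_sub, zero_add]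
    linarith
  | succ k =>
    have e : matVec T y (k + 1) =
        T (k + 1) k * y k + T (k + 1) (k + 1) * y (k + 1) + T (k + 1) (k + 2) * y (k + 2) := by
      have z : ∑ j ∈ Finset.range k, T (k + 1) j * y j = 0 :=
        Finset.sum_eq_zero fun j hj => by
          rw [hT _ _ (Or.inr (by have := Finset.mem_range.1 hj; omega)), zero_mul]
      simp only [matVec, Finset.sum_range_succ, z, zero_add]
    rw [e]
    have := norm_add₃_le (a := T (k + 1) k * y k) (b := T (k + 1) (k + 1) * y (k + 1))
      (c := T (k + 1) (k + 2) * y (k + 2))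
    have h0 := h (k + 1) k
    have h1 := h (k + 1) (k + 1)
    have h2 := h (k + 1) (k + 2)
    simp only [Nat.add_sub_cancel]
    linarith

theorem memℓp_matVec {T : ℕ → ℕ → ℂ} (hT : IsTridiagonal T) (hb : HasBoundedEntries T)
    (y : Ell2) : Memℓp (matVec T y) 2 := by
  obtain ⟨C, hC⟩ := hb
  have hC0 : 0 ≤ C := (norm_nonneg _).trans (hC 0 0)
  have hy : Summable fun i => ‖y i‖ ^ 2 := by
    simpa using (lp.memℓp y).summable (by norm_num)
  have hy1 : Summable fun i => ‖y (i + 1)‖ ^ 2 := (summable_nat_add_iff 1).2 hy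
  have hy2 : Summable fun i => ‖y (i - 1)‖ ^ 2 := by
    rw [← summable_nat_add_iff 1]; simpa using hy
  apply memℓp_gen
  simp only [ENNReal.toReal_ofNat, Real.rpow_ofNat]
  refine Summable.of_nonneg_of_le (fun i => by positivity) (fun i => ?_)
    (((hy2.add hy).add hy1).mul_left (3 * C ^ 2))
  calc ‖matVec T y i‖ ^ 2 ≤ (C * (‖y (i - 1)‖ + ‖y i‖ + ‖y (i + 1)‖)) ^ 2 := by
        gcongr; exact norm_matVec_le hT hC _ i
    _ ≤ _ := by
        rw [mul_pow, mul_comm 3, mul_assoc]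
        gcongr
        nlinarith [sq_nonneg (‖y (i - 1)‖ - ‖y i‖), sq_nonneg (‖y i‖ - ‖y (i + 1)‖),
          sq_nonneg (‖y (i - 1)‖ - ‖y (i + 1)‖)]

/-- The linear operator `y ↦ T y` on square summable sequences. -/
def tridiagonalLin (T : ℕ → ℕ → ℂ) (hT : IsTridiagonal T) (hb : HasBoundedEntries T) :
    Ell2 →ₗ[ℂ] Ell2 where
  toFun y := ⟨matVec T y, memℓp_matVec hT hb y⟩
  map_add' x y := by
    ext i
    change matVec T (x + y : Ell2) i = matVec T x i + matVec T y i
    simp [matVec, mul_add, Finset.sum_add_distrib]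
  map_smul' c y := by
    ext i
    simp [matVec, Finset.mul_sum, mul_left_comm]

theorem continuous_tridiagonalLin (T : ℕ → ℕ → ℂ) (hT : IsTridiagonal T)
    (hb : HasBoundedEntries T) : Continuous (tridiagonalLin T hT hb) := by
  have hc : ∀ i, Continuous fun x : Ell2 => x i := fun i =>
    (continuous_apply i).comp lp.uniformContinuous_coe.continuous
  refine LinearMap.continuous_of_seq_closed_graph _ fun u x y hu hTu => ?_
  ext i
  have h1 : Tendsto (fun n => (tridiagonalLin T hT hb (u n)) i) atTop (𝓝 (y i)) :=
    ((hc i).tendsto y).comp hTu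
  have h2 : Tendsto (fun n => (tridiagonalLin T hT hb (u n)) i) atTop
      (𝓝 ((tridiagonalLin T hT hb x) i)) := by
    have : Continuous fun x : Ell2 => (tridiagonalLin T hT hb x) i := by
      show Continuous fun x : Ell2 => ∑ j ∈ Finset.range (i + 2), T i j * x j
      exact continuous_finsetSum _ fun j _ => continuous_const.mul (hc j)
    exact (this.tendsto x).comp hu
  exact tendsto_nhds_unique h1 h2

/-- The bounded operator on square summable sequences given by a tridiagonal matrix with
bounded entries. -/
def tridiagonalOp (T : ℕ → ℕ → ℂ) (hT : IsTridiagonal T) (hb : HasBoundedEntries T) :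
    Ell2 →L[ℂ] Ell2 :=
  ⟨tridiagonalLin T hT hb, continuous_tridiagonalLin T hT hb⟩

/-- The coefficients of a bounded continued fraction
`1 / (β₀ - αL₀ αR₀ / (β₁ - αL₁ αR₁ / (β₂ - ⋯)))`:
nonzero polynomials of degree at most one with uniformly bounded coefficients. -/
structure BoundedMPFraction where
  β : ℕ → ℂ[X]
  αL : ℕ → ℂ[X]
  αR : ℕ → ℂ[X]
  degree_β : ∀ n, (β n).degree ≤ 1
  degree_αL : ∀ n, (αL n).degree ≤ 1
  degree_αR : ∀ n, (αR n).degree ≤ 1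
  β_ne_zero : ∀ n, β n ≠ 0
  αL_ne_zero : ∀ n, αL n ≠ 0
  αR_ne_zero : ∀ n, αR n ≠ 0
  bounded : ∃ C : ℝ, ∀ n k, ‖(β n).coeff k‖ ≤ C ∧ ‖(αL n).coeff k‖ ≤ C ∧ ‖(αR n).coeff k‖ ≤ C

namespace BoundedMPFraction

variable (F : BoundedMPFraction)

/-- The numerators of the convergents. The recurrence `pₙ₊₁ = βₙ pₙ - αLₙ₋₁ αRₙ₋₁ pₙ₋₁`
with `p₋₁ = -1`, `p₀ = 0` and `αL₋₁ = αR₋₁ = 1` gives `p₁ = 1`. -/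
def num : ℕ → ℂ[X]
  | 0 => 0
  | 1 => 1
  | n + 2 => F.β (n + 1) * num (n + 1) - F.αL n * F.αR n * num n

/-- The denominators of the convergents. The recurrence `qₙ₊₁ = βₙ qₙ - αLₙ₋₁ αRₙ₋₁ qₙ₋₁`
with `q₋₁ = 0`, `q₀ = 1` gives `q₁ = β₀`. -/
def den : ℕ → ℂ[X]
  | 0 => 1
  | 1 => F.β 0
  | n + 2 => F.β (n + 1) * den (n + 1) - F.αL n * F.αR n * den n

/-- The entry in row `i` and column `j` of the tridiagonal pencil `z B - A`, as a polynomial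
in `z`: `βᵢ` on the diagonal, `-αRᵢ` at `(i, i + 1)` and `-αLⱼ` at `(j + 1, j)`. -/
def pencilEntry (i j : ℕ) : ℂ[X] :=
  if i = j then F.β i
  else if j = i + 1 then -F.αR i
  else if i = j + 1 then -F.αL j
  else 0

/-- The infinite matrix `B`: the coefficients of `z` in `z B - A`. -/
def matB (i j : ℕ) : ℂ := (F.pencilEntry i j).coeff 1

/-- The infinite matrix `A`: minus the constant coefficients of `z B - A`. -/
def matA (i j : ℕ) : ℂ := -(F.pencilEntry i j).coeff 0

theorem pencilEntry_eq_zero {i j : ℕ} (h : i + 1 < j ∨ j + 1 < i) : F.pencilEntry i j = 0 := by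
  unfold pencilEntry
  rw [if_neg (by omega), if_neg (by omega), if_neg (by omega)]

theorem exists_norm_coeff_pencilEntry_le :
    ∃ C : ℝ, ∀ i j k, ‖(F.pencilEntry i j).coeff k‖ ≤ C := by
  obtain ⟨C, hC⟩ := F.bounded
  refine ⟨C, fun i j k => ?_⟩
  unfold pencilEntry
  split_ifs
  · exact (hC i k).1
  · simpa using (hC i k).2.2
  · simpa using (hC j k).2.1
  · simpa using (norm_nonneg _).trans (hC 0 0).1

theorem isTridiagonal_matB : IsTridiagonal F.matB := fun i j h => by
  simp [matB, F.pencilEntry_eq_zero h]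

theorem isTridiagonal_matA : IsTridiagonal F.matA := fun i j h => by
  simp [matA, F.pencilEntry_eq_zero h]

theorem hasBoundedEntries_matB : HasBoundedEntries F.matB := by
  obtain ⟨C, hC⟩ := F.exists_norm_coeff_pencilEntry_le
  exact ⟨C, fun i j => hC i j 1⟩

theorem hasBoundedEntries_matA : HasBoundedEntries F.matA := by
  obtain ⟨C, hC⟩ := F.exists_norm_coeff_pencilEntry_le
  exact ⟨C, fun i j => by simpa [matA] using hC i j 0⟩

/-- `B` as a bounded operator. -/
def opB : Ell2 →L[ℂ] Ell2 :=
  tridiagonalOp F.matB F.isTridiagonal_matB F.hasBoundedEntries_matB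

/-- `A` as a bounded operator. -/
def opA : Ell2 →L[ℂ] Ell2 :=
  tridiagonalOp F.matA F.isTridiagonal_matA F.hasBoundedEntries_matA

/-- The resolvent set `ρ(A, B)` in the extended plane: a finite `z` belongs to it iff `z B - A`
has a bounded inverse, and `∞` belongs to it iff `B` has a bounded inverse. -/
def resolventSet : Set (OnePoint ℂ) :=
  {x | (x = ∞ ∧ IsUnit F.opB) ∨ ∃ z : ℂ, x = (z : OnePoint ℂ) ∧ IsUnit (z • F.opB - F.opA)}

/-- The `m`-function `m(z) = ⟨(z B - A)⁻¹ e₀, e₀⟩` (meaningful for `z ∈ ρ(A, B)`); Mathlib's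
inner product is linear in its second argument. -/
def mFunction (z : ℂ) : ℂ :=
  inner ℂ (unitVec 0) (Ring.inverse (z • F.opB - F.opA) (unitVec 0))

end BoundedMPFraction

/-- The root in the extended plane of a nonzero polynomial of degree at most one; it is `∞` if
the degree is zero. -/
def extendedRoot (a : ℂ[X]) : OnePoint ℂ :=
  if a.coeff 1 = 0 then ∞ else ((-a.coeff 0 / a.coeff 1 : ℂ) : OnePoint ℂ)

/-- The interpolation points `z₁, z₂, z₃, …`, numbered from zero (`node i` is the point
with number `i + 1`): `node (2 k)` is the root of `αLₖ` and `node (2 k + 1)` is the root of `αRₖ`. -/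
def BoundedMPFraction.node (F : BoundedMPFraction) (i : ℕ) : OnePoint ℂ :=
  if Even i then extendedRoot (F.αL (i / 2)) else extendedRoot (F.αR (i / 2))

/-- The contour assumption: `G` is a domain of the extended plane whose boundary is a Jordan
curve in the finite plane, it contains all interpolation points, its closure is contained
in `ρ(A, B)`, and `∞ ∈ G` if `∞ ∈ ρ(A, B)`. -/
structure BoundedMPFraction.IsContourDomain (F : BoundedMPFraction) (G : Set (OnePoint ℂ)) :
    Prop where
  isOpen : IsOpen G
  isConnected : IsConnected G
  jordan : ∃ γ : Circle → ℂ, Continuous γ ∧ Function.Injective γ ∧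
    frontier G = Set.range fun t => (γ t : OnePoint ℂ)
  node_mem : ∀ i, F.node i ∈ G
  closure_subset : closure G ⊆ F.resolventSet
  infty_mem : ∞ ∈ F.resolventSet → ∞ ∈ G

open Classical in
/-- The number of times `x` occurs among the first `N` members of the sequence `z`. -/
def nodeMultiplicity (z : ℕ → OnePoint ℂ) (N : ℕ) (x : OnePoint ℂ) : ℕ :=
  ((Finset.range N).filter fun i => z i = x).card

/-- `p / q` is an `[n - 1 | n]` multipoint Padé approximant of `φ` at the first `2 n` points
of the sequence `z` (for `n = 0` the degree condition on `p` means `p = 0`): at a finite point of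
multiplicity `μ > 0` the linearized error `φ q - p` is analytic with a zero of order at least `μ`;
if `∞` occurs with multiplicity `μ > 0`, then the Laurent expansion of `φ q - p` at `∞` starts
with the power `ζ ^ (n - 1 - μ)` or a lower one (for `μ = 2 n`, all points being `∞`, this is the
classical condition `φ q - p = O(ζ ^ (-n - 1))`). -/
structure IsMultipointPade (φ : ℂ → ℂ) (z : ℕ → OnePoint ℂ) (n : ℕ) (p q : ℂ[X]) : Prop where
  degree_num_lt : p.degree < n
  degree_den_le : q.degree ≤ n
  den_ne_zero : q ≠ 0
  finite_nodes : ∀ w : ℂ, (nodeMultiplicity z (2 * n) w : ℕ∞) ≤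
    analyticOrderAt (fun ζ => φ ζ * q.eval ζ - p.eval ζ) w
  infinite_node : 0 < nodeMultiplicity z (2 * n) ∞ →
    ∃ g : ℂ → ℂ, AnalyticAt ℂ g 0 ∧ ∀ᶠ ζ in Bornology.cobounded ℂ,
      φ ζ * q.eval ζ - p.eval ζ =
        ζ ^ ((n : ℤ) - 1 - (nodeMultiplicity z (2 * n) ∞ : ℤ)) * g ζ⁻¹

end

noncomputable section

/-! Let `r_k = res k 0` be the first column of the resolvent. Solving `(zB - A) r = e_0` row by row
gives the recurrence of the convergents up to normalization, hence the error formula `m q_n - p_n =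
(∏_{i<n} αR_i) r_n` (`prod_αR_mul_res`). The product accounts for the roots of the `αR_i`; the roots
of the `αL_i` must be zeros of `r_n`.

At a root `w` of `αL_n` the pencil is block upper triangular with a finite leading block, so its
inverse has the same shape (`res_eq_zero_of_eval_αL_eq_zero`). Near `w`, cutting the column after
index `n` (`res_eq_of_lt`) then exhibits `αL_n r_n` as an analytic factor of every `r_k`, `k > n`
(`exists_res_eq_mul`). Induction counts multiplicities.

That `q_{n+1}` is not identically zero follows from invertibility near the root of `αL_n`, tested on
a finite section of the formal eigenvector (`den_succ_ne_zero`). The point `∞` is moved to `0` by `z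
↦ 1/z`, which turns the fraction into another one of the same class (`reverse`). -/

theorem unitVec_apply (k i : ℕ) : (unitVec k : ℕ → ℂ) i = if i = k then 1 else 0 := by
  rw [unitVec, lp.coeFn_single, Pi.single_apply]

theorem Polynomial.eval_eq_of_degree_le_one {p : ℂ[X]} (hp : p.degree ≤ 1) (z : ℂ) :
    p.eval z = p.coeff 0 + p.coeff 1 * z := by
  have h : p.natDegree < 2 := Nat.lt_succ_of_le (natDegree_le_of_degree_le hp)
  rw [eval_eq_sum_range' h]
  simp [Finset.sum_range_succ]

/-- A polynomial that vanishes on a neighbourhood of a point is zero. -/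
theorem Polynomial.eq_zero_of_eventually_eval_eq_zero {p : ℂ[X]} {w : ℂ}
    (h : ∀ᶠ z in 𝓝 w, p.eval z = 0) : p = 0 :=
  p.eq_zero_of_infinite_isRoot (infinite_of_mem_nhds w h)

theorem analyticAt_eval (p : ℂ[X]) (w : ℂ) : AnalyticAt ℂ (fun z => p.eval z) w :=
  AnalyticOnNhd.eval_polynomial p w (Set.mem_univ w)

theorem matVec_zero_row (T : ℕ → ℕ → ℂ) (y : ℕ → ℂ) :
    matVec T y 0 = T 0 0 * y 0 + T 0 1 * y 1 := by
  simp [matVec, Finset.sum_range_succ]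

theorem matVec_succ_row {T : ℕ → ℕ → ℂ} (hT : IsTridiagonal T) (y : ℕ → ℂ) (k : ℕ) :
    matVec T y (k + 1) =
      T (k + 1) k * y k + T (k + 1) (k + 1) * y (k + 1) + T (k + 1) (k + 2) * y (k + 2) := by
  have z : ∑ j ∈ Finset.range k, T (k + 1) j * y j = 0 :=
    Finset.sum_eq_zero fun j hj => by
      rw [hT _ _ (Or.inr (by have := Finset.mem_range.1 hj; omega)), zero_mul]
  simp only [matVec, Finset.sum_range_succ, z, zero_add]

/-! ### The pencil and its resolvent as infinite matrices. -/

namespace BoundedMPFraction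

variable (F : BoundedMPFraction)

/-- The value `z B - A` of the linear pencil. -/
def pencil (z : ℂ) : Ell2 →L[ℂ] Ell2 := z • F.opB - F.opA

/-- The entry in row `i` and column `j` of the resolvent `(z B - A)⁻¹`. -/
def res (i j : ℕ) (z : ℂ) : ℂ := (Ring.inverse (F.pencil z) (unitVec j) : Ell2) i

theorem mFunction_eq_res (z : ℂ) : F.mFunction z = F.res 0 0 z := by
  rw [mFunction, unitVec, lp.inner_single_left]
  simp [res, pencil, unitVec]

theorem pencil_apply_zero (z : ℂ) (y : Ell2) :
    (F.pencil z y : Ell2) 0 = (F.β 0).eval z * y 0 - (F.αR 0).eval z * y 1 := by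
  change z * matVec F.matB y 0 - matVec F.matA y 0 = _
  rw [matVec_zero_row, matVec_zero_row, eval_eq_of_degree_le_one (F.degree_β 0),
    eval_eq_of_degree_le_one (F.degree_αR 0)]
  simp [matA, matB, pencilEntry]
  ring

theorem pencil_apply_succ (z : ℂ) (y : Ell2) (k : ℕ) :
    (F.pencil z y : Ell2) (k + 1) = -(F.αL k).eval z * y k + (F.β (k + 1)).eval z * y (k + 1)
      - (F.αR (k + 1)).eval z * y (k + 2) := by
  change z * matVec F.matB y (k + 1) - matVec F.matA y (k + 1) = _
  rw [matVec_succ_row F.isTridiagonal_matB, matVec_succ_row F.isTridiagonal_matA,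
    eval_eq_of_degree_le_one (F.degree_β _),
    eval_eq_of_degree_le_one (F.degree_αR _), eval_eq_of_degree_le_one (F.degree_αL _)]
  have hk : k ≠ k + 2 := by omega
  simp [matA, matB, pencilEntry, hk]
  ring

theorem pencil_unitVec_zero (z : ℂ) : F.pencil z (unitVec 0) =
    (F.β 0).eval z • unitVec 0 - (F.αL 0).eval z • unitVec 1 := by
  ext i
  rcases i with _ | i
  · simp only [pencil_apply_zero, unitVec_apply, lp.coeFn_sub, lp.coeFn_smul,
      Pi.sub_apply, Pi.smul_apply, smul_eq_mul]
    simp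
  · simp only [pencil_apply_succ, unitVec_apply, lp.coeFn_sub, lp.coeFn_smul,
      Pi.sub_apply, Pi.smul_apply, smul_eq_mul]
    rcases i with _ | i <;> simp

theorem pencil_unitVec_succ (z : ℂ) (n : ℕ) : F.pencil z (unitVec (n + 1)) =
    -(F.αR n).eval z • unitVec n + (F.β (n + 1)).eval z • unitVec (n + 1)
      - (F.αL (n + 1)).eval z • unitVec (n + 2) := by
  ext i
  rcases i with _ | i
  · simp only [pencil_apply_zero, unitVec_apply, lp.coeFn_sub, lp.coeFn_add, lp.coeFn_smul,
      Pi.add_apply, Pi.sub_apply, Pi.smul_apply, smul_eq_mul]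
    rcases n with _ | n <;> simp
  · simp only [pencil_apply_succ, unitVec_apply, lp.coeFn_sub, lp.coeFn_add, lp.coeFn_smul,
      Pi.add_apply, Pi.sub_apply, Pi.smul_apply, smul_eq_mul]
    by_cases h1 : i = n
    · subst h1; simp
    by_cases h2 : i = n + 1
    · subst h2
      have e : n + 1 + 1 ≠ n := by omega
      simp [e]
    by_cases h3 : i + 1 = n
    · subst h3
      have e : i ≠ i + 1 + 1 := by omega
      simp [e]
    · simp [h1, h2, h3]

theorem pencil_apply_res {z : ℂ} (hz : IsUnit (F.pencil z)) (x : Ell2) :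
    F.pencil z (Ring.inverse (F.pencil z) x) = x := by
  rw [← mul_apply_eq_comp, Ring.mul_inverse_cancel _ hz]; rfl

theorem res_apply_pencil {z : ℂ} (hz : IsUnit (F.pencil z)) (x : Ell2) :
    Ring.inverse (F.pencil z) (F.pencil z x) = x := by
  rw [← mul_apply_eq_comp, Ring.inverse_mul_cancel _ hz]; rfl

/-- Row `k + 1` of `(zB - A) r = e_0`, multiplied by `∏_{i≤k} αR_i`, is the recurrence for `p` and
`q`; row `0` supplies the initial values. Multiplying avoids division by `αR_i`, which may vanish at
`z`. -/
theorem prod_αR_mul_res {z : ℂ} (hz : IsUnit (F.pencil z)) (n : ℕ) :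
    (∏ i ∈ Finset.range n, (F.αR i).eval z) * F.res n 0 z =
      F.mFunction z * (F.den n).eval z - (F.num n).eval z := by
  have hT := F.pencil_apply_res hz (unitVec 0)
  have h0 := congrArg (fun x : Ell2 => x 0) hT
  have hs := fun k => congrArg (fun x : Ell2 => x (k + 1)) hT
  simp only [pencil_apply_zero, unitVec_apply, if_true] at h0
  simp only [pencil_apply_succ, unitVec_apply, Nat.succ_ne_zero, if_false] at hs
  change _ * F.res 0 0 z - _ * F.res 1 0 z = 1 at h0
  change ∀ k, _ * F.res k 0 z + _ * F.res (k + 1) 0 z - _ * F.res (k + 2) 0 z = 0 at hs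
  induction n using Nat.twoStepInduction with
  | zero => simp [mFunction_eq_res, den, num]
  | one => simp [mFunction_eq_res, den, num]; linear_combination -h0
  | more k ih1 ih2 =>
    simp only [Finset.prod_range_succ, den, num, eval_sub, eval_mul] at ih1 ih2 ⊢
    linear_combination (-(∏ i ∈ Finset.range k, (F.αR i).eval z) * (F.αR k).eval z) * hs k
      + (F.β (k + 1)).eval z * ih2 - (F.αL k).eval z * (F.αR k).eval z * ih1

/-! ### Zeros of the first resolvent column at the roots of `αL`. -/

/-- Decoupling the pencil between the indices `n` and `n + 1`. -/
theorem res_eq_of_lt {z : ℂ} (hz : IsUnit (F.pencil z)) {n k : ℕ} (hk : n < k) :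
    F.res k 0 z = (F.αL n).eval z * F.res n 0 z * F.res k (n + 1) z
      - (F.αR n).eval z * F.res (n + 1) 0 z * F.res k n z := by
  have hT := F.pencil_apply_res hz (unitVec 0)
  set x : Ell2 := Ring.inverse (F.pencil z) (unitVec 0) with hx
  -- The tail of the column beyond index `n`. The pencil sends it to zero except in rows `n` and `n
  -- + 1`, the only ones that couple the two sides of the cut.
  set y : Ell2 := x - ∑ j ∈ Finset.range (n + 1), x j • unitVec j with hy
  have hyj : ∀ j, y j = if j ≤ n then 0 else x j := fun j => by
    simp only [hy, lp.coeFn_sub, Pi.sub_apply, lp.coeFn_sum, Finset.sum_apply, lp.coeFn_smul,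
      Pi.smul_apply, unitVec_apply, smul_eq_mul, mul_ite, mul_one, mul_zero, Finset.sum_ite_eq,
      Finset.mem_range, Nat.lt_succ_iff]
    split_ifs <;> simp
  have hs := fun k => congrArg (fun x : Ell2 => x (k + 1)) hT
  simp only [pencil_apply_succ, unitVec_apply, Nat.succ_ne_zero, if_false] at hs
  have hTy : F.pencil z y = ((F.αL n).eval z * x n) • unitVec (n + 1)
      - ((F.αR n).eval z * x (n + 1)) • unitVec n := by
    ext i
    rcases i with _ | i
    · simp only [pencil_apply_zero, hyj, unitVec_apply, lp.coeFn_sub, lp.coeFn_smul,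
        Pi.sub_apply, Pi.smul_apply, smul_eq_mul]
      rcases n with _ | n <;> simp
    · simp only [pencil_apply_succ, hyj, unitVec_apply, lp.coeFn_sub, lp.coeFn_smul,
        Pi.sub_apply, Pi.smul_apply, smul_eq_mul]
      rcases lt_trichotomy i n with h | h | h
      · by_cases h' : i + 1 = n
        · subst h'; simp
        · rw [if_pos (by omega), if_pos (by omega), if_pos (by omega), if_neg (by omega),
            if_neg (by omega)]
          simp
      · subst h
        have := hs i
        simp
        linear_combination this
      · rw [if_neg (by omega), if_neg (by omega), if_neg (by omega), if_neg (by omega),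
            if_neg (by omega), hs i]
        simp
  have h := congrArg (fun u : Ell2 => u k) (F.res_apply_pencil hz y)
  rw [hTy] at h
  simp only [map_sub, _root_.map_smul, lp.coeFn_sub, lp.coeFn_smul, Pi.sub_apply, Pi.smul_apply,
    smul_eq_mul, hyj, if_neg (not_le.2 hk)] at h
  exact h.symm

/-- At a root of `αLₙ` the resolvent is block upper triangular. -/
theorem res_eq_zero_of_eval_αL_eq_zero {w : ℂ} (hw : IsUnit (F.pencil w)) {n : ℕ}
    (h : (F.αL n).eval w = 0) {j k : ℕ} (hj : j ≤ n) (hk : n < k) : F.res k j w = 0 := by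
  let V : Submodule ℂ Ell2 := Submodule.span ℂ (unitVec '' (Finset.range (n + 1) : Set ℕ))
  have : FiniteDimensional ℂ V :=
    FiniteDimensional.span_of_finite ℂ ((Finset.finite_toSet _).image _)
  have hmem : ∀ j ≤ n, unitVec j ∈ V := fun j hj =>
    Submodule.subset_span ⟨j, by simpa using Nat.lt_succ_of_le hj, rfl⟩
  have hTV : ∀ x ∈ V, F.pencil w x ∈ V := by
    intro x hx
    induction hx using Submodule.span_induction with
    | mem x hx =>
      obtain ⟨j, hj, rfl⟩ := hx
      have hj : j ≤ n := by simpa [Nat.lt_succ_iff] using hj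
      -- The only term that could leave `V` is the multiple of `e_{n+1}` coming from `e_n`; its
      -- coefficient is `αL_n(w) = 0`.
      have hlast : ∀ i ≤ n, (F.αL i).eval w • unitVec (i + 1) ∈ V := by
        intro i hi
        rcases hi.eq_or_lt with rfl | hi
        · simp [h]
        · exact V.smul_mem _ (hmem _ hi)
      rcases j with _ | j
      · rw [pencil_unitVec_zero]
        exact V.sub_mem (V.smul_mem _ (hmem _ hj)) (hlast _ hj)
      · rw [pencil_unitVec_succ]
        exact V.sub_mem (V.add_mem (V.smul_mem _ (hmem _ (by omega)))
          (V.smul_mem _ (hmem _ hj))) (hlast _ hj)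
    | zero => simp
    | add x y _ _ hx hy => rw [map_add]; exact V.add_mem hx hy
    | smul c x _ hx => rw [_root_.map_smul]; exact V.smul_mem _ hx
  have hinj : Function.Injective ((F.pencil w : Ell2 →ₗ[ℂ] Ell2).restrict hTV) := by
    intro x y hxy
    have hxy' : F.pencil w x = F.pencil w y := congrArg Subtype.val hxy
    apply Subtype.ext
    rw [← F.res_apply_pencil hw x, hxy', F.res_apply_pencil hw]
  -- Invertibility on the whole space does not make the restriction to an invariant subspace onto;
  -- the finite dimension of `V` does.
  obtain ⟨v, hv⟩ := LinearMap.injective_iff_surjective.1 hinj ⟨unitVec j, hmem j hj⟩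
  have hv' : F.pencil w v = unitVec j := congrArg Subtype.val hv
  have hsupp : ∀ x ∈ V, (x : ℕ → ℂ) k = 0 := by
    intro x hx
    induction hx using Submodule.span_induction with
    | mem x hx =>
      obtain ⟨i, hi, rfl⟩ := hx
      have hi : i ≤ n := by simpa [Nat.lt_succ_iff] using hi
      rw [unitVec_apply, if_neg (by omega)]
    | zero => simp
    | add x y _ _ hx hy => simp [hx, hy]
    | smul c x _ hx => simp [hx]
  rw [res, ← hv', F.res_apply_pencil hw]
  exact hsupp _ v.2

theorem eventually_isUnit_pencil {w : ℂ} (hw : IsUnit (F.pencil w)) :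
    ∀ᶠ z in 𝓝 w, IsUnit (F.pencil z) := by
  have hc : Continuous F.pencil := by unfold pencil; fun_prop
  exact hc.continuousAt.eventually (Units.isOpen.mem_nhds hw)

theorem analyticAt_res {w : ℂ} (hw : IsUnit (F.pencil w)) (i j : ℕ) :
    AnalyticAt ℂ (F.res i j) w := by
  have h1 : AnalyticAt ℂ F.pencil w := by unfold pencil; fun_prop
  have h2 : AnalyticAt ℂ (fun z => Ring.inverse (F.pencil z)) w :=
    (analyticOnNhd_inverse (𝕜 := ℂ) (A := Ell2 →L[ℂ] Ell2) (F.pencil w) hw).comp h1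
  have h3 := ((innerSL ℂ (unitVec i)).comp
    (ContinuousLinearMap.apply ℂ Ell2 (unitVec j))).analyticAt (Ring.inverse (F.pencil w))
  refine (AnalyticAt.comp (f := fun z => Ring.inverse (F.pencil z)) h3 h2).congr (Eventually.of_forall fun z => ?_)
  simp [res, unitVec, lp.inner_single_left]

/-- The decoupling identity with index `n + 1` is a linear equation for `r_{n+1}`, solvable near
`w`; inserting the solution for general `k` makes `αL_n r_n` a common factor. -/
theorem exists_res_eq_mul {w : ℂ} (hw : IsUnit (F.pencil w)) {n : ℕ}
    (h : (F.αL n).eval w = 0) {k : ℕ} (hk : n < k) :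
    ∃ g : ℂ → ℂ, AnalyticAt ℂ g w ∧
      F.res k 0 =ᶠ[𝓝 w] fun z => (F.αL n).eval z * F.res n 0 z * g z := by
  -- The coefficient of `r_{n+1}` in that equation; it equals `1` at `w` by block triangularity.
  set d : ℂ → ℂ := fun z => 1 + (F.αR n).eval z * F.res (n + 1) n z with hd
  have hda : AnalyticAt ℂ d w :=
    analyticAt_const.add ((analyticAt_eval _ w).mul (F.analyticAt_res hw _ _))
  have hdw : d w ≠ 0 := by
    simp [hd, F.res_eq_zero_of_eval_αL_eq_zero hw h le_rfl (Nat.lt_succ_self n)]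
  refine ⟨fun z => F.res k (n + 1) z
      - (F.αR n).eval z * (F.res (n + 1) (n + 1) z / d z) * F.res k n z,
    (F.analyticAt_res hw _ _).sub (((analyticAt_eval _ w).mul
      ((F.analyticAt_res hw _ _).div hda hdw)).mul (F.analyticAt_res hw _ _)), ?_⟩
  filter_upwards [F.eventually_isUnit_pencil hw, hda.continuousAt.eventually_ne hdw] with z hz hdz
  have h1 := F.res_eq_of_lt hz hk
  have h2 : F.res (n + 1) 0 z =
      (F.αL n).eval z * F.res n 0 z * (F.res (n + 1) (n + 1) z / d z) := by
    rw [mul_div_assoc', eq_div_iff hdz]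
    have := F.res_eq_of_lt hz (Nat.lt_succ_self n)
    simp only [hd]
    linear_combination this
  rw [h1, h2]
  ring

/-- Each `αL_n` vanishing at `w` adds one to the order already known for `r_n`. The induction runs
over all `k ≥ n`: it is applied at `n` itself when `αL_n(w) = 0` and at `k` otherwise. -/
theorem card_filter_αL_le_analyticOrderAt_res {w : ℂ} (hw : IsUnit (F.pencil w)) (n : ℕ) :
    ∀ k, n ≤ k → (((Finset.range n).filter fun i => (F.αL i).eval w = 0).card : ℕ∞) ≤
      analyticOrderAt (F.res k 0) w := by
  induction n with
  | zero => simp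
  | succ n ih =>
    intro k hk
    rw [Finset.range_add_one, Finset.filter_insert]
    split_ifs with h
    · obtain ⟨g, hg, hgk⟩ := F.exists_res_eq_mul hw h hk
      have hα := analyticAt_eval (F.αL n) w
      have hr := F.analyticAt_res hw n 0
      rw [Finset.card_insert_of_notMem (by simp), analyticOrderAt_congr hgk,
        show (fun z => (F.αL n).eval z * F.res n 0 z * g z) =
          (fun z => (F.αL n).eval z) * F.res n 0 * g from rfl,
        analyticOrderAt_mul (hα.mul hr) hg, analyticOrderAt_mul hα hr, Nat.cast_add, Nat.cast_one,
        add_comm]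
      refine le_add_right (add_le_add ?_ (ih n le_rfl))
      exact Order.one_le_iff_ne_zero.2 (hα.analyticOrderAt_ne_zero.2 h)
    · exact ih k (by omega)

theorem card_filter_αR_le_analyticOrderAt_prod (w : ℂ) (n : ℕ) :
    (((Finset.range n).filter fun i => (F.αR i).eval w = 0).card : ℕ∞) ≤
      analyticOrderAt (fun z => ∏ i ∈ Finset.range n, (F.αR i).eval z) w := by
  induction n with
  | zero => simp
  | succ n ih =>
    have hα := analyticAt_eval (F.αR n) w
    have hp : AnalyticAt ℂ (fun z => ∏ i ∈ Finset.range n, (F.αR i).eval z) w :=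
      Finset.analyticAt_fun_prod _ fun i _ => analyticAt_eval _ w
    rw [show (fun z => ∏ i ∈ Finset.range (n + 1), (F.αR i).eval z) =
        (fun z => ∏ i ∈ Finset.range n, (F.αR i).eval z) * fun z => (F.αR n).eval z from
          funext fun z => Finset.prod_range_succ _ _, analyticOrderAt_mul hp hα,
      Finset.range_add_one, Finset.filter_insert]
    split_ifs with h
    · rw [Finset.card_insert_of_notMem (by simp), Nat.cast_add, Nat.cast_one]
      exact add_le_add ih (Order.one_le_iff_ne_zero.2 (hα.analyticOrderAt_ne_zero.2 h))
    · exact le_add_right ih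

/-- The linearized error vanishes at `w` at least as often as the product of the first `n`
off-diagonal pairs of coefficients. -/
theorem card_add_card_le_analyticOrderAt_error {w : ℂ} (hw : IsUnit (F.pencil w)) (n : ℕ) :
    (((Finset.range n).filter fun i => (F.αL i).eval w = 0).card +
      ((Finset.range n).filter fun i => (F.αR i).eval w = 0).card : ℕ∞) ≤
      analyticOrderAt (fun z => F.mFunction z * (F.den n).eval z - (F.num n).eval z) w := by
  have h : (fun z => F.mFunction z * (F.den n).eval z - (F.num n).eval z) =ᶠ[𝓝 w]
      (fun z => ∏ i ∈ Finset.range n, (F.αR i).eval z) * F.res n 0 := by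
    filter_upwards [F.eventually_isUnit_pencil hw] with z hz
    exact (F.prod_αR_mul_res hz n).symm
  rw [analyticOrderAt_congr h, analyticOrderAt_mul
    (Finset.analyticAt_fun_prod _ fun i _ => analyticAt_eval _ w) (F.analyticAt_res hw _ _),
    add_comm]
  exact add_le_add (F.card_filter_αR_le_analyticOrderAt_prod w n)
    (F.card_filter_αL_le_analyticOrderAt_res hw n n le_rfl)

/-! ### Nonvanishing of the denominators, and degrees. -/

/-- A finite section of the formal eigenvector of the pencil. -/
theorem exists_pencil_apply_eq (z : ℂ) (n : ℕ) : ∃ v : Ell2,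
    F.pencil z v = (F.den (n + 1)).eval z • unitVec n
      - ((F.αL n).eval z * (F.den n).eval z) • unitVec (n + 1) ∧
    v n = (F.den n).eval z ∧ (∀ k, n < k → v k = 0) ∧ v 0 = ∏ i ∈ Finset.range n, (F.αR i).eval z := by
  induction n with
  | zero => exact ⟨unitVec 0, by simp [pencil_unitVec_zero, den], by simp [unitVec_apply, den],
      fun k hk => by rw [unitVec_apply, if_neg (by omega)], by simp [unitVec_apply]⟩
  | succ n ih =>
    obtain ⟨v, hv, hvn, hvk, hv0⟩ := ih
    -- Scaling by `αR_n` makes the `e_n` components cancel without dividing; this is why `v 0`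
    -- becomes the product of the `αR_i`.
    refine ⟨(F.αR n).eval z • v + (F.den (n + 1)).eval z • unitVec (n + 1), ?_, ?_, ?_, ?_⟩
    · rw [map_add, _root_.map_smul, _root_.map_smul, hv, pencil_unitVec_succ,
        show F.den (n + 1 + 1) = F.β (n + 1) * F.den (n + 1) - F.αL n * F.αR n * F.den n from rfl,
        eval_sub, eval_mul, eval_mul, eval_mul]
      module
    · rw [lp.coeFn_add, lp.coeFn_smul, lp.coeFn_smul, Pi.add_apply, Pi.smul_apply, Pi.smul_apply,
        hvk _ (Nat.lt_succ_self n), unitVec_apply]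
      simp
    · intro k hk
      rw [lp.coeFn_add, lp.coeFn_smul, lp.coeFn_smul, Pi.add_apply, Pi.smul_apply, Pi.smul_apply,
        hvk _ (by omega), unitVec_apply, if_neg (by omega)]
      simp
    · rw [lp.coeFn_add, lp.coeFn_smul, lp.coeFn_smul, Pi.add_apply, Pi.smul_apply, Pi.smul_apply,
        hv0, unitVec_apply, Finset.prod_range_succ]
      simp [mul_comm]

/-- If `q_{n+1} ≡ 0`, the finite section `v` is `-αL_n q_n` times column `n + 1` of the resolvent.
Its entry `n` gives `q_n (1 + αL_n res n (n+1)) = 0`, where the bracket is nonzero near `w`. So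
`q_n`, then `v`, then `v 0 = ∏ αR_i` vanish near `w`, although no `αR_i` is the zero polynomial. -/
theorem den_succ_ne_zero {w : ℂ} (hw : IsUnit (F.pencil w)) {n : ℕ}
    (h : (F.αL n).eval w = 0) : F.den (n + 1) ≠ 0 := by
  intro h0
  have hd : AnalyticAt ℂ (fun z => 1 + (F.αL n).eval z * F.res n (n + 1) z) w :=
    analyticAt_const.add ((analyticAt_eval _ w).mul (F.analyticAt_res hw _ _))
  have hprod : (∏ i ∈ Finset.range n, F.αR i) = 0 := by
    refine eq_zero_of_eventually_eval_eq_zero (w := w) ?_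
    filter_upwards [F.eventually_isUnit_pencil hw,
      hd.continuousAt.eventually_ne (by simp [h] : _ ≠ (0 : ℂ))] with z hz hdz
    obtain ⟨v, hv, hvn, -, hv0⟩ := F.exists_pencil_apply_eq z n
    rw [h0, eval_zero, zero_smul, zero_sub] at hv
    have hv' := F.res_apply_pencil hz v
    rw [hv, map_neg, _root_.map_smul] at hv'
    have hn : -((F.αL n).eval z * (F.den n).eval z * F.res n (n + 1) z) = v n :=
      congrArg (fun u : Ell2 => u n) hv'
    have hden : (F.den n).eval z = 0 := by
      refine (mul_eq_zero.1 (?_ : _ * (1 + (F.αL n).eval z * F.res n (n + 1) z) = 0)).resolve_right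
        hdz
      rw [hvn] at hn
      linear_combination -hn
    rw [eval_prod, ← hv0, ← hv', hden]
    simp
  exact Finset.prod_ne_zero_iff.2 (fun i _ => F.αR_ne_zero i) hprod

theorem natDegree_den_le (n : ℕ) : (F.den n).natDegree ≤ n := by
  induction n using Nat.twoStepInduction with
  | zero => simp [den]
  | one => exact natDegree_le_of_degree_le (n := 1) (F.degree_β 0)
  | more n ih1 ih2 =>
    have hβ := natDegree_le_of_degree_le (n := 1) (F.degree_β (n + 1))
    have hL := natDegree_le_of_degree_le (n := 1) (F.degree_αL n)
    have hR := natDegree_le_of_degree_le (n := 1) (F.degree_αR n)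
    refine (natDegree_sub_le_of_le (natDegree_mul_le_of_le hβ ih2)
      (natDegree_mul_le_of_le (natDegree_mul_le_of_le hL hR) ih1)).trans (max_le ?_ ?_) <;> omega

theorem natDegree_num_succ_le (n : ℕ) : (F.num (n + 1)).natDegree ≤ n := by
  induction n using Nat.twoStepInduction with
  | zero => simp [num]
  | one => simpa [num] using natDegree_le_of_degree_le (n := 1) (F.degree_β 1)
  | more n ih1 ih2 =>
    have hβ := natDegree_le_of_degree_le (n := 1) (F.degree_β (n + 2))
    have hL := natDegree_le_of_degree_le (n := 1) (F.degree_αL (n + 1))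
    have hR := natDegree_le_of_degree_le (n := 1) (F.degree_αR (n + 1))
    refine (natDegree_sub_le_of_le (natDegree_mul_le_of_le hβ ih2)
      (natDegree_mul_le_of_le (natDegree_mul_le_of_le hL hR) ih1)).trans (max_le ?_ ?_) <;> omega

theorem degree_num_lt (n : ℕ) : (F.num n).degree < n := by
  rcases n with _ | n
  · simp [num]
  · exact (degree_le_of_natDegree_le (F.natDegree_num_succ_le n)).trans_lt
      (by exact_mod_cast Nat.lt_succ_self n)

end BoundedMPFraction

/-! ### The change of variable `z ↦ 1/z`. -/

/-- The reversal `z p(1 / z)` of a polynomial of degree at most one. -/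
def Polynomial.linearReverse (p : ℂ[X]) : ℂ[X] := C (p.coeff 0) * X + C (p.coeff 1)

theorem Polynomial.coeff_zero_linearReverse (p : ℂ[X]) :
    p.linearReverse.coeff 0 = p.coeff 1 := by
  simp [linearReverse]

theorem Polynomial.coeff_one_linearReverse (p : ℂ[X]) :
    p.linearReverse.coeff 1 = p.coeff 0 := by
  simp [linearReverse, coeff_C]

theorem Polynomial.degree_linearReverse_le (p : ℂ[X]) : p.linearReverse.degree ≤ 1 :=
  degree_linear_le

theorem Polynomial.linearReverse_ne_zero {p : ℂ[X]} (hp : p.degree ≤ 1) (h : p ≠ 0) :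
    p.linearReverse ≠ 0 := by
  intro h0
  apply h
  have h1 : p.coeff 1 = 0 := by rw [← coeff_zero_linearReverse, h0, coeff_zero]
  have h2 : p.coeff 0 = 0 := by rw [← coeff_one_linearReverse, h0, coeff_zero]
  rw [eq_X_add_C_of_degree_le_one hp, h1, h2]
  simp

theorem Polynomial.eval_linearReverse {p : ℂ[X]} (hp : p.degree ≤ 1) {z : ℂ} (hz : z ≠ 0) :
    p.linearReverse.eval z = z * p.eval z⁻¹ := by
  rw [eval_eq_of_degree_le_one hp, eval_eq_of_degree_le_one p.degree_linearReverse_le,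
    coeff_zero_linearReverse, coeff_one_linearReverse]
  field_simp
  ring

theorem Polynomial.norm_coeff_linearReverse_le {p : ℂ[X]} {c : ℝ} (h : ∀ k, ‖p.coeff k‖ ≤ c)
    (k : ℕ) : ‖p.linearReverse.coeff k‖ ≤ c := by
  rcases k with _ | _ | k
  · rw [coeff_zero_linearReverse]; exact h 1
  · rw [coeff_one_linearReverse]; exact h 0
  · simpa [linearReverse, coeff_X, coeff_C] using (norm_nonneg _).trans (h 0)

namespace BoundedMPFraction

variable (F : BoundedMPFraction)

/-- The fraction obtained by the change of variable `z ↦ 1 / z`. -/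
def reverse : BoundedMPFraction where
  β n := (F.β n).linearReverse
  αL n := (F.αL n).linearReverse
  αR n := (F.αR n).linearReverse
  degree_β n := (F.β n).degree_linearReverse_le
  degree_αL n := (F.αL n).degree_linearReverse_le
  degree_αR n := (F.αR n).degree_linearReverse_le
  β_ne_zero n := linearReverse_ne_zero (F.degree_β n) (F.β_ne_zero n)
  αL_ne_zero n := linearReverse_ne_zero (F.degree_αL n) (F.αL_ne_zero n)
  αR_ne_zero n := linearReverse_ne_zero (F.degree_αR n) (F.αR_ne_zero n)
  bounded := by
    obtain ⟨c, hc⟩ := F.bounded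
    exact ⟨c, fun n k => ⟨norm_coeff_linearReverse_le (fun k => (hc n k).1) k,
      norm_coeff_linearReverse_le (fun k => (hc n k).2.1) k,
      norm_coeff_linearReverse_le (fun k => (hc n k).2.2) k⟩⟩

theorem pencil_reverse {z : ℂ} (hz : z ≠ 0) : F.reverse.pencil z = z • F.pencil z⁻¹ := by
  ext y i
  rw [smul_apply]
  change _ = z * (F.pencil z⁻¹ y : Ell2) i
  rcases i with _ | i
  · rw [pencil_apply_zero, pencil_apply_zero]
    simp only [reverse]
    rw [eval_linearReverse (F.degree_β _) hz, eval_linearReverse (F.degree_αR _) hz]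
    ring
  · rw [pencil_apply_succ, pencil_apply_succ]
    simp only [reverse]
    rw [eval_linearReverse (F.degree_β _) hz, eval_linearReverse (F.degree_αR _) hz,
      eval_linearReverse (F.degree_αL _) hz]
    ring

/-- Thus `∞ ∈ ρ(A, B)` makes `0` a regular point of the reversed pencil, where the finite theory
applies. -/
theorem pencil_reverse_zero : F.reverse.pencil 0 = F.opB := by
  ext y i
  change (0 : ℂ) * _ - matVec F.reverse.matA y i = matVec F.matB y i
  rw [zero_mul, zero_sub, matVec, matVec, ← Finset.sum_neg_distrib]
  refine Finset.sum_congr rfl fun j _ => ?_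
  have : -F.reverse.matA i j = F.matB i j := by
    simp only [matA, matB, pencilEntry, reverse]
    split_ifs <;> simp [coeff_zero_linearReverse]
  rw [← this, neg_mul]

theorem mFunction_reverse {z : ℂ} (hz : z ≠ 0) (hu : IsUnit (F.pencil z⁻¹)) :
    z * F.reverse.mFunction z = F.mFunction z⁻¹ := by
  have h : Ring.inverse (F.reverse.pencil z) = z⁻¹ • Ring.inverse (F.pencil z⁻¹) := by
    rw [pencil_reverse F hz]
    obtain ⟨u, hu⟩ := hu
    rw [← hu, Ring.inverse_unit,
      show z • (u : Ell2 →L[ℂ] Ell2) = ((Units.mk0 z hz • u : (Ell2 →L[ℂ] Ell2)ˣ) : _) from rfl,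
      Ring.inverse_unit]
    rfl
  rw [mFunction_eq_res, mFunction_eq_res, res, h]
  change z * (z⁻¹ * F.res 0 0 z⁻¹) = _
  rw [mul_inv_cancel_left₀ hz]

theorem eval_den_reverse {z : ℂ} (hz : z ≠ 0) (n : ℕ) :
    (F.reverse.den n).eval z = z ^ n * (F.den n).eval z⁻¹ := by
  induction n using Nat.twoStepInduction with
  | zero => simp [den]
  | one =>
    rw [pow_one]
    exact eval_linearReverse (F.degree_β 0) hz
  | more n ih1 ih2 =>
    simp only [den, eval_sub, eval_mul, ih1, ih2]
    simp only [reverse]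
    rw [eval_linearReverse (F.degree_β _) hz, eval_linearReverse (F.degree_αR _) hz,
      eval_linearReverse (F.degree_αL _) hz]
    ring

/-- The numerator has degree at most `n - 1`; the factor `z` on the left replaces that exponent and
keeps `n = 0` valid. -/
theorem eval_num_reverse {z : ℂ} (hz : z ≠ 0) (n : ℕ) :
    z * (F.reverse.num n).eval z = z ^ n * (F.num n).eval z⁻¹ := by
  induction n using Nat.twoStepInduction with
  | zero => simp [num]
  | one => simp [num]
  | more n ih1 ih2 =>
    simp only [num, eval_sub, eval_mul, mul_sub, mul_left_comm z, ih1, ih2]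
    simp only [reverse]
    rw [eval_linearReverse (F.degree_β _) hz, eval_linearReverse (F.degree_αR _) hz,
      eval_linearReverse (F.degree_αL _) hz]
    ring

theorem den_eq_zero_of_reverse {n : ℕ} (h : F.den n = 0) : F.reverse.den n = 0 := by
  refine eq_zero_of_infinite_isRoot _ (((Set.finite_singleton (0 : ℂ)).infinite_compl).mono ?_)
  intro z hz
  change (F.reverse.den n).eval z = 0
  rw [F.eval_den_reverse hz, h, eval_zero, mul_zero]

end BoundedMPFraction

/-! ### Interpolation nodes, finite and infinite. -/

theorem extendedRoot_eq_infty_iff {a : ℂ[X]} : extendedRoot a = ∞ ↔ a.coeff 1 = 0 := by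
  unfold extendedRoot
  split_ifs with h <;> simp [h]

theorem eval_eq_zero_of_extendedRoot_eq {a : ℂ[X]} (ha : a.degree ≤ 1) {w : ℂ}
    (h : extendedRoot a = w) : a.eval w = 0 := by
  unfold extendedRoot at h
  split_ifs at h with h0
  · exact absurd h (infty_ne_coe w)
  · rw [eval_eq_of_degree_le_one ha, ← OnePoint.coe_injective h, mul_div_cancel₀ _ h0,
      add_neg_cancel]

open Classical in
theorem nodeMultiplicity_two_mul (z : ℕ → OnePoint ℂ) (n : ℕ) (x : OnePoint ℂ) :
    nodeMultiplicity z (2 * n) x = ((Finset.range n).filter fun i => z (2 * i) = x).card +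
      ((Finset.range n).filter fun i => z (2 * i + 1) = x).card := by
  unfold nodeMultiplicity
  induction n with
  | zero => simp
  | succ n ih =>
    simp only [Finset.card_filter] at ih ⊢
    rw [show 2 * (n + 1) = 2 * n + 1 + 1 by ring, Finset.sum_range_succ, Finset.sum_range_succ, ih,
      Finset.sum_range_succ, Finset.sum_range_succ]
    ring

namespace BoundedMPFraction

variable (F : BoundedMPFraction)

theorem node_two_mul (k : ℕ) : F.node (2 * k) = extendedRoot (F.αL k) := by
  simp [node]

theorem node_two_mul_add_one (k : ℕ) : F.node (2 * k + 1) = extendedRoot (F.αR k) := by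
  have h : (2 * k + 1) / 2 = k := by omega
  simp [node, h]

variable {F}

theorem exists_node_eq {n : ℕ} {x : OnePoint ℂ} (h : 0 < nodeMultiplicity F.node n x) :
    ∃ i, F.node i = x := by
  classical
  obtain ⟨i, hi⟩ := Finset.card_pos.1 h
  exact ⟨i, (Finset.mem_filter.1 hi).2⟩

theorem isUnit_pencil_of_mem {w : ℂ} (h : (w : OnePoint ℂ) ∈ F.resolventSet) :
    IsUnit (F.pencil w) := by
  rcases h with ⟨h, -⟩ | ⟨z, h, hz⟩
  · exact absurd h (coe_ne_infty w)
  · rw [OnePoint.coe_injective h]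
    exact hz

theorem isUnit_opB_of_mem (h : ∞ ∈ F.resolventSet) : IsUnit F.opB := by
  rcases h with ⟨-, h⟩ | ⟨z, h, -⟩
  · exact h
  · exact absurd h (infty_ne_coe z)

theorem den_ne_zero (hF : ∀ i, F.node i ∈ F.resolventSet) (n : ℕ) : F.den n ≠ 0 := by
  rcases n with _ | n
  · simp [den]
  -- `q_{n+1}` is tested at the root of `αL_n`; an infinite root becomes the root `0` of the
  -- reversed polynomial.
  have h := hF (2 * n)
  rw [node_two_mul] at h
  rcases hx : extendedRoot (F.αL n) with _ | w
  · have hx : extendedRoot (F.αL n) = ∞ := hx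
    rw [hx] at h
    intro h0
    refine F.reverse.den_succ_ne_zero (w := 0) (n := n) ?_ ?_ (F.den_eq_zero_of_reverse h0)
    · rw [pencil_reverse_zero]
      exact isUnit_opB_of_mem h
    · rw [← coeff_zero_eq_eval_zero]
      exact (coeff_zero_linearReverse _).trans (extendedRoot_eq_infty_iff.1 hx)
  · have hx : extendedRoot (F.αL n) = (w : OnePoint ℂ) := hx
    rw [hx] at h
    exact F.den_succ_ne_zero (isUnit_pencil_of_mem h)
      (eval_eq_zero_of_extendedRoot_eq (F.degree_αL n) hx)

theorem nodeMultiplicity_le_analyticOrderAt (hF : ∀ i, F.node i ∈ F.resolventSet) (n : ℕ) (w : ℂ) :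
    (nodeMultiplicity F.node (2 * n) w : ℕ∞) ≤
      analyticOrderAt (fun z => F.mFunction z * (F.den n).eval z - (F.num n).eval z) w := by
  classical
  rcases Nat.eq_zero_or_pos (nodeMultiplicity F.node (2 * n) w) with h | h
  · simp [h]
  obtain ⟨i, hi⟩ := exists_node_eq h
  refine le_trans ?_ (F.card_add_card_le_analyticOrderAt_error
    (isUnit_pencil_of_mem (hi ▸ hF i)) n)
  rw [nodeMultiplicity_two_mul]
  simp only [node_two_mul, node_two_mul_add_one]
  exact_mod_cast add_le_add
    (Finset.card_le_card (Finset.monotone_filter_right _ fun i _ hi =>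
      eval_eq_zero_of_extendedRoot_eq (F.degree_αL i) hi))
    (Finset.card_le_card (Finset.monotone_filter_right _ fun i _ hi =>
      eval_eq_zero_of_extendedRoot_eq (F.degree_αR i) hi))

/-- The reversed error has a zero of order at least `μ` at `0`. In the exponent `n - 1 - μ`, `n`
comes from reversing the denominator and `-1` from the factor relating the two `m`-functions. -/
theorem exists_error_eq_at_infty (hB : IsUnit F.opB) (n : ℕ) :
    ∃ g : ℂ → ℂ, AnalyticAt ℂ g 0 ∧ ∀ᶠ z in Bornology.cobounded ℂ,
      F.mFunction z * (F.den n).eval z - (F.num n).eval z =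
        z ^ ((n : ℤ) - 1 - (nodeMultiplicity F.node (2 * n) ∞ : ℤ)) * g z⁻¹ := by
  classical
  have hu : IsUnit (F.reverse.pencil 0) := by rwa [pencil_reverse_zero]
  have hle : (nodeMultiplicity F.node (2 * n) ∞ : ℕ∞) ≤ analyticOrderAt
      (fun z => F.reverse.mFunction z * (F.reverse.den n).eval z - (F.reverse.num n).eval z) 0 := by
    refine le_trans ?_ (F.reverse.card_add_card_le_analyticOrderAt_error hu n)
    rw [nodeMultiplicity_two_mul]
    simp only [node_two_mul, node_two_mul_add_one, extendedRoot_eq_infty_iff]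
    simp only [reverse, ← coeff_zero_eq_eval_zero, coeff_zero_linearReverse]
    push_cast
    exact le_rfl
  have han : AnalyticAt ℂ (fun z => F.reverse.mFunction z * (F.reverse.den n).eval z
      - (F.reverse.num n).eval z) 0 := by
    simp only [mFunction_eq_res]
    exact ((F.reverse.analyticAt_res hu 0 0).mul (analyticAt_eval _ 0)).sub (analyticAt_eval _ 0)
  obtain ⟨g, hg, hgz⟩ := (natCast_le_analyticOrderAt han).1 hle
  refine ⟨g, hg, ?_⟩
  filter_upwards [tendsto_inv₀_cobounded.eventually hgz,
    tendsto_inv₀_cobounded.eventually (F.reverse.eventually_isUnit_pencil hu),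
    Bornology.eventually_ne_cobounded (0 : ℂ)] with z hz huz hz0
  have hz0' : z⁻¹ ≠ 0 := inv_ne_zero hz0
  -- For `z ≠ 0` the two pencils differ by a nonzero scalar, so invertibility near `0` yields
  -- invertibility of the original pencil near `∞`.
  have hu' : IsUnit (F.pencil z⁻¹⁻¹) := by
    have h := huz.smul (Units.mk0 z hz0)
    rwa [pencil_reverse F hz0', Units.smul_mk0, smul_inv_smul₀ hz0] at h
  have hm := F.mFunction_reverse hz0' hu'
  have hd := F.eval_den_reverse hz0' n
  have hn := F.eval_num_reverse hz0' n
  rw [inv_inv] at hm hd hn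
  rw [sub_zero, smul_eq_mul] at hz
  have key : z⁻¹ ^ n * (F.mFunction z * (F.den n).eval z - (F.num n).eval z) =
      z⁻¹ * (z⁻¹ ^ nodeMultiplicity F.node (2 * n) ∞ * g z⁻¹) := by
    rw [← hz, ← hm, mul_sub, ← hn, hd]
    ring
  rw [zpow_sub₀ hz0, zpow_sub₀ hz0, zpow_one, zpow_natCast, zpow_natCast]
  refine mul_left_cancel₀ (pow_ne_zero n hz0') ?_
  rw [key, inv_pow, inv_pow]
  generalize g z⁻¹ = c
  field_simp

end BoundedMPFraction

end

theorem corollary2p6 (F : BoundedMPFraction) (G : Set (OnePoint ℂ)) (hG : F.IsContourDomain G)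
    (n : ℕ) : IsMultipointPade F.mFunction F.node n (F.num n) (F.den n) := by
  have hF : ∀ i, F.node i ∈ F.resolventSet := fun i =>
    hG.closure_subset (subset_closure (hG.node_mem i))
  refine ⟨F.degree_num_lt n, degree_le_of_natDegree_le (F.natDegree_den_le n),
    BoundedMPFraction.den_ne_zero hF n, fun w =>
      BoundedMPFraction.nodeMultiplicity_le_analyticOrderAt hF n w, fun h => ?_⟩
  obtain ⟨i, hi⟩ := BoundedMPFraction.exists_node_eq h
  exact BoundedMPFraction.exists_error_eq_at_infty
    (BoundedMPFraction.isUnit_opB_of_mem (hi ▸ hF i)) n
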